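/- Let $0<q<1$ and $v>-1$, let $d_qx=(1-q)\sum_{n\in\mathbb Z}q^n\delta_{q^n}$, and let $\omega:\mathbb R\to\mathbb R$ be an even function with $\omega(q^n)\neq 0$ for all $n\in\mathbb Z$. Let $\mu$ be the measure on $\mathbb R$ given by $$d\mu(x)=\omega(x)^2\,|x|^{2v+1}\,d_qx ,$$ and suppose that $\mu$ has finite moments $s_n=\int x^n\,d\mu(x)$ of every order $n\ge 0$. If $$\lim_{n\to\infty}q^{n/4}\,\bigl(s_{2n}\bigr)^{1/(2n)}=0,$$ then $\mu$ is determinate: $\mu$ is the only positive measure on $\mathbb R$ with infinite support and finite moments of every order whose moments are $(s_n)_{n\ge 0}$. -/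

import Mathlib

open MeasureTheory Filter Topology

namespace QMoment

noncomputable section

/-- The class `𝓜*(ℝ)` of positive Borel measures on `ℝ` that have moments of every order
and whose support is infinite. -/
def momentClass : Set (Measure ℝ) :=
  {μ | (∀ n : ℕ, Integrable (fun x : ℝ => x ^ n) μ) ∧ μ.support.Infinite}

/-- The `n`-th moment `s_n = ∫ x ^ n dμ(x)` of a measure on `ℝ`. -/
def moment (μ : Measure ℝ) (n : ℕ) : ℝ := ∫ x, x ^ n ∂μ

/-- The set `V_μ` of the measures in `𝓜*(ℝ)` that have the same moments as `μ`. -/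
def sameMoments (μ : Measure ℝ) : Set (Measure ℝ) :=
  {ν | ν ∈ momentClass ∧ ∀ n : ℕ, moment μ n = moment ν n}

/-- `μ` is determinate: it belongs to `𝓜*(ℝ)` and it is the only measure in `𝓜*(ℝ)` with its
moments. -/
def IsDeterminate (μ : Measure ℝ) : Prop :=
  μ ∈ momentClass ∧ sameMoments μ = {μ}

/-- The discrete measure `d_q x = (1 - q) ∑_{n ∈ ℤ} q ^ n δ_{q ^ n}`. -/
def dq (q : ℝ) : Measure ℝ :=
  Measure.sum fun n : ℤ => ENNReal.ofReal ((1 - q) * q ^ n) • Measure.dirac (q ^ n)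

/-- The measure `dσ(x) = |x| ^ (2 v + 1) d_q x`. -/
def sigma (q v : ℝ) : Measure ℝ :=
  (dq q).withDensity fun x => ENNReal.ofReal (|x| ^ (2 * v + 1))

/-- The measure `dμ(x) = ω(x) ^ 2 dσ(x) = ω(x) ^ 2 |x| ^ (2 v + 1) d_q x`. -/
def mu (q v : ℝ) (ω : ℝ → ℝ) : Measure ℝ :=
  (sigma q v).withDensity fun x => ENNReal.ofReal (ω x ^ 2)

end

end QMoment

/-!
The measure `μ = mu q v ω` is carried by the lattice `{q ^ k | k ∈ ℤ}`, and the idea is to test it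
against squares of polynomials that vanish on long pieces of the lattice. Let `P_M` be the product
of the factors `1 - x / q ^ i` over `-4 M ≤ i ≤ M`, except that, for a given real number `a`, the
factor with zero at `a` is left out, if there is one. At the lattice points in `(0, q ^ M)` one has
`0 ≤ P_M ≤ 1`, and at those beyond `q ^ (-4 M)` the square of `P_M` is at most
`q ^ (15 M ^ 2 + 3 M) x ^ (2 n)` with `n = 5 M + 1`. Hence
`∫ P_M ^ 2 ∂μ ≤ μ {a} P_M(a) ^ 2 + μ (0, q ^ M) + q ^ (15 M ^ 2 + 3 M) s_{2n}`
(`integral_sq_latticePoly_le`). The growth condition gives `s_{2n} ≤ q ^ (-n ^ 2 / 2)` for large `n`,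
so the last two terms tend to zero (`tendsto_excess`). On the other hand `|P_M(x)|` is bounded below
by a positive constant independent of `M` at each point `x` where no `P_M` vanishes
(`exists_pos_le_abs_eval_latticePoly`).

If `ν` has the same moments as `μ`, then `∫ P_M ^ 2 ∂ν = ∫ P_M ^ 2 ∂μ`. For `a` outside the lattice
Fatou's lemma shows that `ν` is carried by the lattice too (`ae_exists_eq_zpow`), and for each `a`
the limit `M → ∞` gives `ν {a} ≤ μ {a}` (`measure_singleton_le`). So `ν ≤ μ`, and `ν = μ` since both
have the total mass `s_0`.
-/

namespace QMoment

open Polynomial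
open scoped ENNReal

noncomputable section

/-! ### Polynomials vanishing on the lattice -/

/-- The polynomial `∏ i ∈ F, (1 - X / q ^ i)`, normalised to be `1` at `0`. -/
def latticePoly (q : ℝ) (F : Finset ℤ) : ℝ[X] := ∏ i ∈ F, (1 - C ((q ^ i)⁻¹) * X)

lemma eval_latticePoly (q : ℝ) (F : Finset ℤ) (x : ℝ) :
    (latticePoly q F).eval x = ∏ i ∈ F, (1 - x / q ^ i) := by
  simp [latticePoly, eval_prod, div_eq_inv_mul]

lemma one_sub_sum_le_prod_one_sub {ι : Type*} (s : Finset ι) (h : ι → ℝ)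
    (h0 : ∀ i, 0 ≤ h i) (h1 : ∀ i, h i ≤ 1) : 1 - ∑ i ∈ s, h i ≤ ∏ i ∈ s, (1 - h i) := by
  classical
  induction s using Finset.induction_on with
  | empty => simp
  | insert a s ha ih =>
    rw [Finset.sum_insert ha, Finset.prod_insert ha]
    have hp : ∏ i ∈ s, (1 - h i) ≤ 1 :=
      Finset.prod_le_one (fun i _ => sub_nonneg.2 (h1 i)) fun i _ => by linarith [h0 i]
    nlinarith [h0 a]

/-- The finite products of a family `1 - h i` with `0 ≤ h i ≤ 1` and `h` summable stay away from
zero, as long as no factor vanishes. -/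
lemma exists_pos_le_prod_one_sub {ι : Type*} (h : ι → ℝ) (h0 : ∀ i, 0 ≤ h i)
    (h1 : ∀ i, h i ≤ 1) (hs : Summable h) :
    ∃ c > 0, ∀ F : Finset ι, (∀ i ∈ F, h i ≠ 1) → c ≤ ∏ i ∈ F, (1 - h i) := by
  classical
  obtain ⟨S, hS⟩ := summable_iff_vanishing_norm.1 hs (1 / 2) (by norm_num)
  refine ⟨(∏ i ∈ S with h i ≠ 1, (1 - h i)) * (1 / 2), ?_, fun F hF => ?_⟩
  · refine mul_pos (Finset.prod_pos fun i hi => ?_) (by norm_num)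
    exact sub_pos.2 (lt_of_le_of_ne (h1 i) (Finset.mem_filter.1 hi).2)
  · rw [← Finset.prod_inter_mul_prod_sdiff F S]
    refine mul_le_mul ?_ ?_ (by norm_num) (Finset.prod_nonneg fun i _ => sub_nonneg.2 (h1 i))
    · refine Finset.prod_le_prod_of_subset_of_le_one ?_ (fun i _ => sub_nonneg.2 (h1 i))
        fun i _ _ => by linarith [h0 i]
      intro i hi
      rw [Finset.mem_inter] at hi
      exact Finset.mem_filter.2 ⟨hi.2, hF i hi.1⟩
    · have h2 := hS (F \ S) Finset.sdiff_disjoint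
      have h3 := one_sub_sum_le_prod_one_sub (F \ S) h h0 h1
      rw [Real.norm_eq_abs] at h2
      linarith [(abs_lt.1 h2).2]

/-- Away from their zeros, all the polynomials `latticePoly q F` are bounded below at a given point
by one positive constant: only finitely many factors are smaller than `1 / 2` in absolute value,
and those close to `1` deviate from it by a geometric sequence. -/
lemma exists_pos_le_abs_eval_latticePoly {q : ℝ} (hq0 : 0 < q) (hq1 : q < 1) (x : ℝ) :
    ∃ c > 0, ∀ F : Finset ℤ, (∀ i ∈ F, x ≠ q ^ i) → c ≤ |(latticePoly q F).eval x| := by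
  -- `h i` is the amount by which the factor `|1 - x / q ^ i|` falls below `1`
  set h : ℤ → ℝ := fun i => 1 - min 1 |1 - x / q ^ i| with hh
  have h0 : ∀ i, 0 ≤ h i := fun i => sub_nonneg.2 (min_le_left _ _)
  have h1 : ∀ i, h i ≤ 1 := fun i =>
    sub_le_self _ (le_min zero_le_one (abs_nonneg _))
  have hle : ∀ i, h i ≤ |x| * q ^ (-i) := by
    intro i
    have e : |x| * q ^ (-i) = |x / q ^ i| := by
      rw [abs_div, abs_of_pos (zpow_pos hq0 i), zpow_neg, div_eq_mul_inv]
    have : 1 - |x / q ^ i| ≤ |1 - x / q ^ i| := by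
      simpa using abs_sub_abs_le_abs_sub 1 (x / q ^ i)
    rw [e]
    rcases min_choice 1 |1 - x / q ^ i| with h' | h' <;> simp only [hh, h']
    · simp
    · linarith
  have hzero : ∀ i, 2 * q ^ i ≤ |x| → h i = 0 := by
    intro i hi
    have e : 2 ≤ |x / q ^ i| := by
      rw [abs_div, abs_of_pos (zpow_pos hq0 i)]
      exact (le_div_iff₀ (zpow_pos hq0 i)).2 hi
    have : |x / q ^ i| - 1 ≤ |1 - x / q ^ i| := by
      simpa [abs_sub_comm] using abs_sub_abs_le_abs_sub (x / q ^ i) 1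
    have : min 1 |1 - x / q ^ i| = 1 := min_eq_left (by linarith)
    simp [hh, this]
  have hs : Summable h := by
    have hgeo : Summable fun n : ℕ => |x| * q ^ n :=
      (summable_geometric_of_lt_one hq0.le hq1).mul_left _
    apply Summable.of_nat_of_neg
    · by_cases hx : x = 0
      · refine summable_zero.congr fun n => ?_
        have := hle n
        simp only [hx, abs_zero, zero_mul] at this
        exact (le_antisymm this (h0 _)).symm
      · have ht : Tendsto (fun n : ℕ => 2 * q ^ n) atTop (𝓝 (2 * 0)) :=
          (tendsto_pow_atTop_nhds_zero_of_lt_one hq0.le hq1).const_mul 2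
        rw [mul_zero] at ht
        obtain ⟨N, hN⟩ := eventually_atTop.1 (ht.eventually_le_const (abs_pos.2 hx))
        refine summable_of_ne_finset_zero (s := Finset.range N) fun n hn => ?_
        exact hzero n (by simpa using hN n (by simpa using hn))
    · exact hgeo.of_nonneg_of_le (fun n => h0 _) fun n => by simpa using hle (-n)
  obtain ⟨c, hc, H⟩ := exists_pos_le_prod_one_sub h h0 h1 hs
  refine ⟨c, hc, fun F hF => (H F fun i hi => ?_).trans ?_⟩
  · have hne : (1 : ℝ) - x / q ^ i ≠ 0 := by
      rw [sub_ne_zero]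
      intro e
      exact hF i hi (by simpa using ((eq_div_iff (zpow_pos hq0 i).ne').1 e).symm)
    have := lt_min one_pos (abs_pos.2 hne)
    simp only [hh]
    linarith
  · rw [eval_latticePoly, Finset.abs_prod]
    refine Finset.prod_le_prod (fun i _ => sub_nonneg.2 (h1 i)) fun i _ => ?_
    rw [hh, sub_sub_cancel]
    exact min_le_right _ _

open Classical in
/-- The exponents `-4 M, …, M`, without the one (if any) for which `q ^ i = a`. -/
def nodes (q : ℝ) (M : ℕ) (a : ℝ) : Finset ℤ :=
  {i ∈ (Finset.range (5 * M + 1)).image (fun j : ℕ => (j : ℤ) - 4 * M) | a ≠ q ^ i}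

lemma mem_nodes {q : ℝ} {M : ℕ} {a : ℝ} {i : ℤ} :
    i ∈ nodes q M a ↔ (-(4 * M : ℤ) ≤ i ∧ i ≤ M) ∧ a ≠ q ^ i := by
  simp only [nodes, Finset.mem_filter, Finset.mem_image, Finset.mem_range]
  refine and_congr_left fun _ => ⟨?_, fun h => ⟨(i + 4 * M).toNat, ?_, ?_⟩⟩
  · rintro ⟨j, hj, rfl⟩
    omega
  · omega
  · omega

lemma prod_range_zpow {q : ℝ} (hq0 : 0 < q) (x : ℝ) (N n : ℕ) :
    ∏ j ∈ Finset.range n, (x / q ^ ((j : ℤ) - N)) ^ 2 =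
      q ^ (2 * N * n - n * (n - 1) : ℤ) * x ^ (2 * n) := by
  induction n with
  | zero => simp
  | succ n ih =>
    rw [Finset.prod_range_succ, ih, div_pow, div_eq_mul_inv, ← zpow_natCast (q ^ _), ← zpow_mul,
      ← zpow_neg]
    have e : (2 * N * ((n + 1 : ℕ) : ℤ) - ((n + 1 : ℕ) : ℤ) * (((n + 1 : ℕ) : ℤ) - 1) : ℤ) =
        (2 * N * n - n * (n - 1) : ℤ) + -(((n : ℤ) - N) * ((2 : ℕ) : ℤ)) := by
      push_cast; ring
    rw [e, zpow_add₀ hq0.ne']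
    ring

/-- On the lattice, the square of the polynomial with zeros `q ^ i`, `-4 M ≤ i ≤ M`, `q ^ i ≠ a`,
is at most `1` below the zeros, and at most the square of its leading term above them. -/
lemma sq_eval_latticePoly_le {q : ℝ} (hq0 : 0 < q) (hq1 : q < 1) (M : ℕ) (a : ℝ) (k : ℤ) :
    (latticePoly q (nodes q M a)).eval (q ^ k) ^ 2 ≤
      ({a} : Set ℝ).indicator (fun _ => (latticePoly q (nodes q M a)).eval a ^ 2) (q ^ k) +
      (Set.Ioo 0 (q ^ M)).indicator (fun _ => 1) (q ^ k) +
      q ^ (15 * M ^ 2 + 3 * M) * (q ^ k) ^ (2 * (5 * M + 1)) := by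
  have hk := zpow_pos hq0 k
  have n1 : 0 ≤ ({a} : Set ℝ).indicator
      (fun _ => (latticePoly q (nodes q M a)).eval a ^ 2) (q ^ k) :=
    Set.indicator_nonneg (fun _ _ => sq_nonneg _) _
  have n2 : (0 : ℝ) ≤ (Set.Ioo 0 (q ^ M)).indicator (fun _ => (1 : ℝ)) (q ^ k) :=
    Set.indicator_nonneg (fun _ _ => zero_le_one) _
  have n3 : 0 ≤ q ^ (15 * M ^ 2 + 3 * M) * (q ^ k) ^ (2 * (5 * M + 1)) := by positivity
  by_cases hka : q ^ k = a
  · rw [Set.indicator_of_mem (s := {a}) (by simpa using hka)]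
    rw [← hka]
    linarith
  rcases lt_or_ge (M : ℤ) k with hMk | hMk
  · -- all factors lie in `[0, 1]`
    have hx : q ^ k < q ^ M := by
      rw [← zpow_natCast]; exact zpow_lt_zpow_right_of_lt_one₀ hq0 hq1 hMk
    rw [Set.indicator_of_mem (s := Set.Ioo 0 (q ^ M)) ⟨hk, hx⟩]
    have hf : ∀ i ∈ nodes q M a, 0 ≤ 1 - q ^ k / q ^ i ∧ 1 - q ^ k / q ^ i ≤ 1 := by
      intro i hi
      have hi' := (mem_nodes.1 hi).1.2
      have hpi := zpow_pos hq0 i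
      have : q ^ k ≤ q ^ i := zpow_le_zpow_right_of_le_one₀ hq0 hq1.le (by omega)
      exact ⟨sub_nonneg.2 ((div_le_one hpi).2 this), sub_le_self _ (by positivity)⟩
    have : (latticePoly q (nodes q M a)).eval (q ^ k) ^ 2 ≤ 1 := by
      rw [eval_latticePoly]
      exact pow_le_one₀ (Finset.prod_nonneg fun i hi => (hf i hi).1)
        (Finset.prod_le_one (fun i hi => (hf i hi).1) fun i hi => (hf i hi).2)
    linarith
  rcases le_or_gt (-(4 * M : ℤ)) k with hk4 | hk4
  · have : (latticePoly q (nodes q M a)).eval (q ^ k) = 0 := by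
      rw [eval_latticePoly]
      refine Finset.prod_eq_zero (mem_nodes.2 ⟨⟨hk4, hMk⟩, Ne.symm hka⟩) ?_
      rw [div_self hk.ne', sub_self]
    rw [this]
    linarith
  · -- each factor is at most `q ^ k / q ^ i` in absolute value, and this is at least `1`,
    -- so that the factor left out may be put back
    have key : (latticePoly q (nodes q M a)).eval (q ^ k) ^ 2 ≤
        q ^ (15 * M ^ 2 + 3 * M) * (q ^ k) ^ (2 * (5 * M + 1)) := by
      have hge : ∀ i : ℤ, -(4 * M : ℤ) ≤ i → 1 ≤ q ^ k / q ^ i := fun i hi =>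
        (one_le_div (zpow_pos hq0 i)).2 (zpow_le_zpow_right_of_le_one₀ hq0 hq1.le (by omega))
      have e := prod_range_zpow hq0 (q ^ k) (4 * M) (5 * M + 1)
      have e2 : (2 * ((4 * M : ℕ) : ℤ) * ((5 * M + 1 : ℕ) : ℤ) -
          ((5 * M + 1 : ℕ) : ℤ) * (((5 * M + 1 : ℕ) : ℤ) - 1) : ℤ) =
          ((15 * M ^ 2 + 3 * M : ℕ) : ℤ) := by
        push_cast; ring
      rw [e2, zpow_natCast] at e
      rw [← e, eval_latticePoly, ← Finset.prod_pow]
      calc ∏ i ∈ nodes q M a, (1 - q ^ k / q ^ i) ^ 2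
          ≤ ∏ i ∈ nodes q M a, (q ^ k / q ^ i) ^ 2 := by
            refine Finset.prod_le_prod (fun i _ => sq_nonneg _) fun i hi => ?_
            have := hge i (mem_nodes.1 hi).1.1
            nlinarith
        _ ≤ ∏ i ∈ (Finset.range (5 * M + 1)).image (fun j : ℕ => (j : ℤ) - (4 * M : ℕ)),
              (q ^ k / q ^ i) ^ 2 := by
            have hsub : nodes q M a ⊆
                (Finset.range (5 * M + 1)).image (fun j : ℕ => (j : ℤ) - (4 * M : ℕ)) := by
              intro i hi
              have := (mem_nodes.1 hi).1
              simp only [Finset.mem_image, Finset.mem_range]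
              exact ⟨(i + 4 * M).toNat, by omega, by omega⟩
            refine Finset.prod_le_prod_of_subset_of_one_le hsub
              (fun i _ => sq_nonneg _) fun i hi _ => one_le_pow₀ (hge i ?_)
            simp only [Finset.mem_image] at hi
            obtain ⟨j, -, rfl⟩ := hi
            omega
        _ = _ := Finset.prod_image fun i _ j _ hij => by simpa using hij
    linarith

/-! ### Integration of polynomials -/

lemma integrable_eval {μ : Measure ℝ} (h : ∀ n : ℕ, Integrable (fun x : ℝ => x ^ n) μ)
    (p : ℝ[X]) : Integrable (fun x => p.eval x) μ := by
  simp_rw [eval_eq_sum_range]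
  exact integrable_finsetSum _ fun i _ => (h i).const_mul _

lemma integral_eval_eq {μ ν : Measure ℝ} (hμ : ∀ n : ℕ, Integrable (fun x : ℝ => x ^ n) μ)
    (hν : ∀ n : ℕ, Integrable (fun x : ℝ => x ^ n) ν) (h : ∀ n, moment μ n = moment ν n)
    (p : ℝ[X]) : ∫ x, p.eval x ∂μ = ∫ x, p.eval x ∂ν := by
  simp_rw [eval_eq_sum_range]
  rw [integral_finsetSum _ fun i _ => (hμ i).const_mul _,
    integral_finsetSum _ fun i _ => (hν i).const_mul _]
  refine Finset.sum_congr rfl fun i _ => ?_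
  rw [integral_const_mul, integral_const_mul]
  exact congrArg _ (h i)

lemma integrable_eval_sq {μ : Measure ℝ} (h : ∀ n : ℕ, Integrable (fun x : ℝ => x ^ n) μ)
    (p : ℝ[X]) : Integrable (fun x => p.eval x ^ 2) μ :=
  (integrable_eval h (p ^ 2)).congr (.of_forall fun _ => eval_pow 2)

lemma isFiniteMeasure_of_integrable_pow {μ : Measure ℝ}
    (h : ∀ n : ℕ, Integrable (fun x : ℝ => x ^ n) μ) : IsFiniteMeasure μ := by
  simpa [integrable_const_iff] using h 0

/-- A bound, for a measure `μ` on the lattice, on what `∫ P ^ 2 ∂μ` exceeds `μ {a} P(a) ^ 2` by,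
where `P` has the zeros `q ^ i`, `-4 M ≤ i ≤ M`, `q ^ i ≠ a`. -/
def excess (q : ℝ) (μ : Measure ℝ) (M : ℕ) : ℝ :=
  μ.real (Set.Ioo 0 (q ^ M)) + q ^ (15 * M ^ 2 + 3 * M) * moment μ (2 * (5 * M + 1))

lemma integral_sq_latticePoly_le {q : ℝ} (hq0 : 0 < q) (hq1 : q < 1) {μ : Measure ℝ}
    (hμ : ∀ n : ℕ, Integrable (fun x : ℝ => x ^ n) μ) (hL : ∀ᵐ x ∂μ, ∃ k : ℤ, x = q ^ k)
    (M : ℕ) (a : ℝ) :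
    ∫ x, (latticePoly q (nodes q M a)).eval x ^ 2 ∂μ ≤
      μ.real {a} * (latticePoly q (nodes q M a)).eval a ^ 2 + excess q μ M := by
  have := isFiniteMeasure_of_integrable_pow hμ
  set P := latticePoly q (nodes q M a)
  have i1 : Integrable (({a} : Set ℝ).indicator (fun _ => P.eval a ^ 2)) μ :=
    (integrable_const _).indicator (measurableSet_singleton a)
  have i2 : Integrable ((Set.Ioo 0 (q ^ M)).indicator (fun _ => (1 : ℝ))) μ :=
    (integrable_const _).indicator measurableSet_Ioo
  have i3 := (hμ (2 * (5 * M + 1))).const_mul (q ^ (15 * M ^ 2 + 3 * M))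
  have i0 : Integrable (fun x => P.eval x ^ 2) μ :=
    integrable_eval_sq hμ P
  calc ∫ x, P.eval x ^ 2 ∂μ
      ≤ ∫ x, (({a} : Set ℝ).indicator (fun _ => P.eval a ^ 2) x +
          (Set.Ioo 0 (q ^ M)).indicator (fun _ => (1 : ℝ)) x +
          q ^ (15 * M ^ 2 + 3 * M) * x ^ (2 * (5 * M + 1))) ∂μ := by
        refine integral_mono_ae i0 ((i1.add i2).add i3) ?_
        filter_upwards [hL] with x hx
        obtain ⟨k, rfl⟩ := hx
        exact sq_eval_latticePoly_le hq0 hq1 M a k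
    _ = _ := by
        rw [integral_add (by exact i1.add i2) i3, integral_add i1 i2,
          integral_indicator_const _ (measurableSet_singleton a),
          integral_indicator_const _ measurableSet_Ioo, integral_const_mul]
        simp only [smul_eq_mul, mul_one, excess, moment]
        ring

/-! ### The growth condition -/

lemma moment_two_mul_nonneg (μ : Measure ℝ) (n : ℕ) : 0 ≤ moment μ (2 * n) :=
  integral_nonneg fun x => (even_two_mul n).pow_nonneg x

/-- The growth condition in the form `s_{2n} ≤ q ^ (-n ^ 2 / 2)` for large `n`. -/
lemma eventually_moment_le {q : ℝ} (hq0 : 0 < q) {μ : Measure ℝ}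
    (hlim : Tendsto (fun n : ℕ => q ^ ((n : ℝ) / 4) * moment μ (2 * n) ^ (1 / (2 * (n : ℝ))))
      atTop (𝓝 0)) :
    ∀ᶠ n : ℕ in atTop, q ^ ((n : ℝ) ^ 2 / 2) * moment μ (2 * n) ≤ 1 := by
  filter_upwards [hlim.eventually_le_const one_pos, eventually_gt_atTop 0] with n hn hn0
  have hs := moment_two_mul_nonneg μ n
  have hn' : (n : ℝ) ≠ 0 := by positivity
  have h := pow_le_one₀ (n := 2 * n)
    (mul_nonneg (Real.rpow_nonneg hq0.le _) (Real.rpow_nonneg hs _)) hn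
  rw [mul_pow, ← Real.rpow_natCast, ← Real.rpow_natCast, ← Real.rpow_mul hq0.le,
    ← Real.rpow_mul hs] at h
  have e1 : (n : ℝ) / 4 * ((2 * n : ℕ) : ℝ) = (n : ℝ) ^ 2 / 2 := by push_cast; ring
  have e2 : 1 / (2 * (n : ℝ)) * ((2 * n : ℕ) : ℝ) = 1 := by push_cast; field_simp
  rwa [e1, e2, Real.rpow_one] at h

/-- The first term tends to `0` since `μ` is finite, the second one by the growth condition for
`n = 5 M + 1`, as `15 M ^ 2 + 3 M - (5 M + 1) ^ 2 / 2` tends to infinity. -/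
lemma tendsto_excess {q : ℝ} (hq0 : 0 < q) (hq1 : q < 1) {μ : Measure ℝ} [IsFiniteMeasure μ]
    (hlim : Tendsto (fun n : ℕ => q ^ ((n : ℝ) / 4) * moment μ (2 * n) ^ (1 / (2 * (n : ℝ))))
      atTop (𝓝 0)) :
    Tendsto (excess q μ) atTop (𝓝 0) := by
  have hq := tendsto_pow_atTop_nhds_zero_of_lt_one hq0.le hq1
  rw [← add_zero (0 : ℝ)]
  refine Tendsto.add ?_ ?_
  · have hemp : ⋂ M : ℕ, Set.Ioo 0 (q ^ M) = ∅ := by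
      refine Set.eq_empty_of_forall_notMem fun x hx => ?_
      rw [Set.mem_iInter] at hx
      obtain ⟨M, hM⟩ := (hq.eventually_lt_const (hx 0).1).exists
      exact lt_asymm hM (hx M).2
    have h := tendsto_measure_iInter_atTop (μ := μ) (s := fun M : ℕ => Set.Ioo 0 (q ^ M))
      (fun M => measurableSet_Ioo.nullMeasurableSet)
      (fun m n hmn => Set.Ioo_subset_Ioo_right (pow_le_pow_of_le_one hq0.le hq1.le hmn))
      ⟨0, measure_ne_top _ _⟩
    rw [hemp, measure_empty] at h
    exact (ENNReal.tendsto_toReal ENNReal.zero_ne_top).comp h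
  · have ht : Tendsto (fun M : ℕ => 5 * M + 1) atTop atTop :=
      tendsto_atTop_mono (fun M => by simp only [id]; omega) tendsto_id
    refine squeeze_zero' (.of_forall fun M => ?_) ?_ hq
    · exact mul_nonneg (by positivity) (moment_two_mul_nonneg μ _)
    filter_upwards [ht.eventually (eventually_moment_le hq0 hlim), eventually_ge_atTop 2]
      with M hM hM2
    have hM2' : (2 : ℝ) ≤ M := by exact_mod_cast hM2
    -- `15 M² + 3 M = M + (5 M + 1)² / 2 + r` with `r ≥ 0`
    have hexp : (q : ℝ) ^ (15 * M ^ 2 + 3 * M) ≤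
        q ^ M * q ^ (((5 * M + 1 : ℕ) : ℝ) ^ 2 / 2) := by
      rw [← Real.rpow_natCast, ← Real.rpow_natCast q M, ← Real.rpow_add hq0]
      refine Real.rpow_le_rpow_of_exponent_ge hq0 hq1.le ?_
      push_cast
      nlinarith
    calc q ^ (15 * M ^ 2 + 3 * M) * moment μ (2 * (5 * M + 1))
        ≤ q ^ M * q ^ (((5 * M + 1 : ℕ) : ℝ) ^ 2 / 2) * moment μ (2 * (5 * M + 1)) :=
          mul_le_mul_of_nonneg_right hexp (moment_two_mul_nonneg μ _)
      _ ≤ q ^ M * 1 := by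
          rw [mul_assoc]
          exact mul_le_mul_of_nonneg_left hM (by positivity)
      _ = q ^ M := mul_one _

/-! ### Determinacy of measures on the lattice -/

section Comparison

variable {q : ℝ} {μ ν : Measure ℝ}

/-- A measure with the moments of `μ` is carried by the lattice: the squares of the polynomials
vanishing on ever larger parts of the lattice have integrals tending to `0`, and are bounded away
from `0` at each point outside the lattice. -/
lemma ae_exists_eq_zpow (hq0 : 0 < q) (hq1 : q < 1)
    (hμ : ∀ n : ℕ, Integrable (fun x : ℝ => x ^ n) μ)
    (hν : ∀ n : ℕ, Integrable (fun x : ℝ => x ^ n) ν) (h : ∀ n, moment μ n = moment ν n)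
    (hL : ∀ᵐ x ∂μ, ∃ k : ℤ, x = q ^ k) (hE : Tendsto (excess q μ) atTop (𝓝 0)) :
    ∀ᵐ x ∂ν, ∃ k : ℤ, x = q ^ k := by
  -- `a = 0` is not a lattice point, so no zero is left out
  set P : ℕ → ℝ[X] := fun M => latticePoly q (nodes q M 0)
  have hμ0 : μ.real {0} = 0 := by
    have : ∀ᵐ x ∂μ, x ∉ ({0} : Set ℝ) := by
      filter_upwards [hL] with x hx
      obtain ⟨k, rfl⟩ := hx
      simpa using (zpow_pos hq0 k).ne'
    rw [Measure.real, measure_eq_zero_iff_ae_notMem.2 this, ENNReal.toReal_zero]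
  have hle : ∀ M, ∫⁻ x, ENNReal.ofReal ((P M).eval x ^ 2) ∂ν ≤ ENNReal.ofReal (excess q μ M) := by
    intro M
    have hint : Integrable (fun x => (P M).eval x ^ 2) ν :=
      integrable_eval_sq hν (P M)
    rw [← ofReal_integral_eq_lintegral_ofReal hint (.of_forall fun x => sq_nonneg _)]
    refine ENNReal.ofReal_le_ofReal ?_
    have e := integral_eval_eq hμ hν h (P M ^ 2)
    have b := integral_sq_latticePoly_le hq0 hq1 hμ hL M 0
    simp only [eval_pow] at e
    rw [hμ0, zero_mul, zero_add] at b
    exact e ▸ b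
  have hmeas : ∀ M, Measurable fun x => ENNReal.ofReal ((P M).eval x ^ 2) := fun M =>
    (((P M).continuous.pow 2).measurable).ennreal_ofReal
  have hfatou : ∫⁻ x, liminf (fun M => ENNReal.ofReal ((P M).eval x ^ 2)) atTop ∂ν = 0 := by
    refine le_antisymm ((lintegral_liminf_le hmeas).trans ?_) bot_le
    refine (liminf_le_liminf (.of_forall hle)).trans ?_
    have := (ENNReal.continuous_ofReal.tendsto 0).comp hE
    rw [ENNReal.ofReal_zero] at this
    exact this.liminf_eq.le
  rw [lintegral_eq_zero_iff (Measurable.liminf hmeas)] at hfatou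
  filter_upwards [hfatou] with x hx
  by_contra hne
  push Not at hne
  obtain ⟨c, hc, hcP⟩ := exists_pos_le_abs_eval_latticePoly hq0 hq1 x
  have : ENNReal.ofReal (c ^ 2) ≤ liminf (fun M => ENNReal.ofReal ((P M).eval x ^ 2)) atTop := by
    refine le_liminf_of_le (by isBoundedDefault) (.of_forall fun M => ?_)
    refine ENNReal.ofReal_le_ofReal ?_
    rw [← sq_abs ((P M).eval x)]
    exact pow_le_pow_left₀ hc.le (hcP _ fun i _ => hne i) 2
  rw [hx] at this
  exact absurd (le_antisymm this bot_le) (ENNReal.ofReal_pos.2 (by positivity)).ne'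

/-- The mass at `a` is at most that of `μ`: test both measures against polynomials vanishing on
ever larger parts of the lattice without `a`. -/
lemma measure_singleton_le [IsFiniteMeasure μ] [IsFiniteMeasure ν] (hq0 : 0 < q) (hq1 : q < 1)
    (hμ : ∀ n : ℕ, Integrable (fun x : ℝ => x ^ n) μ)
    (hν : ∀ n : ℕ, Integrable (fun x : ℝ => x ^ n) ν) (h : ∀ n, moment μ n = moment ν n)
    (hL : ∀ᵐ x ∂μ, ∃ k : ℤ, x = q ^ k) (hE : Tendsto (excess q μ) atTop (𝓝 0)) (a : ℝ) :
    ν {a} ≤ μ {a} := by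
  obtain ⟨c, hc, hcP⟩ := exists_pos_le_abs_eval_latticePoly hq0 hq1 a
  rw [← ENNReal.toReal_le_toReal (measure_ne_top _ _) (measure_ne_top _ _)]
  by_contra! hlt
  change μ.real {a} < ν.real {a} at hlt
  have key : ∀ M, c ^ 2 * (ν.real {a} - μ.real {a}) ≤ excess q μ M := by
    intro M
    set P := latticePoly q (nodes q M a)
    have hP : c ^ 2 ≤ P.eval a ^ 2 := by
      rw [← sq_abs (P.eval a)]
      exact pow_le_pow_left₀ hc.le (hcP _ fun i hi => (mem_nodes.1 hi).2) 2
    have hint : Integrable (fun x => P.eval x ^ 2) ν :=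
      integrable_eval_sq hν P
    have e := integral_eval_eq hμ hν h (P ^ 2)
    simp only [eval_pow] at e
    have b : ∫ x, P.eval x ^ 2 ∂μ ≤ μ.real {a} * P.eval a ^ 2 + excess q μ M :=
      integral_sq_latticePoly_le hq0 hq1 hμ hL M a
    have l : ν.real {a} * P.eval a ^ 2 ≤ ∫ x, P.eval x ^ 2 ∂ν := by
      rw [← smul_eq_mul, ← integral_singleton (fun x => P.eval x ^ 2) a]
      exact setIntegral_le_integral hint (.of_forall fun x => sq_nonneg _)
    nlinarith
  have h0 := ge_of_tendsto' hE key
  exact hlt.not_ge (sub_nonpos.1 (nonpos_of_mul_nonpos_right h0 (by positivity)))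

/-- A measure on the lattice `{q ^ k | k ∈ ℤ}` whose moments satisfy the growth condition is
determined by them among all measures with finite moments. -/
theorem eq_of_moment_eq (hq0 : 0 < q) (hq1 : q < 1)
    (hμ : ∀ n : ℕ, Integrable (fun x : ℝ => x ^ n) μ)
    (hν : ∀ n : ℕ, Integrable (fun x : ℝ => x ^ n) ν) (h : ∀ n, moment μ n = moment ν n)
    (hL : ∀ᵐ x ∂μ, ∃ k : ℤ, x = q ^ k)
    (hlim : Tendsto (fun n : ℕ => q ^ ((n : ℝ) / 4) * moment μ (2 * n) ^ (1 / (2 * (n : ℝ))))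
      atTop (𝓝 0)) :
    ν = μ := by
  have := isFiniteMeasure_of_integrable_pow hμ
  have := isFiniteMeasure_of_integrable_pow hν
  have hE := tendsto_excess hq0 hq1 hlim
  have hLν := ae_exists_eq_zpow hq0 hq1 hμ hν h hL hE
  have hcount : (Set.range fun k : ℤ => q ^ k).Countable := Set.countable_range _
  refine Measure.eq_of_le_of_measure_univ_eq (Measure.le_iff.2 fun s _ => ?_) ?_
  · set T := s ∩ Set.range fun k : ℤ => q ^ k
    have hT : T.Countable := hcount.mono Set.inter_subset_right
    have e : ∀ ρ : Measure ℝ, ρ T = ∑' a : T, ρ {(a : ℝ)} := by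
      intro ρ
      conv_lhs => rw [← Set.biUnion_of_singleton T]
      exact measure_biUnion hT (fun a _ b _ hab => by simpa using hab)
        fun a _ => measurableSet_singleton a
    calc ν s = ν T := by
          refine (measure_inter_conull ?_).symm
          rw [measure_eq_zero_iff_ae_notMem]
          filter_upwards [hLν] with x hx
          obtain ⟨k, rfl⟩ := hx
          simp
      _ ≤ μ T := by
          rw [e ν, e μ]
          exact ENNReal.tsum_le_tsum fun a => measure_singleton_le hq0 hq1 hμ hν h hL hE a
      _ ≤ μ s := measure_mono Set.inter_subset_left
  · have h0 := h 0
    simp only [moment, pow_zero, integral_const, smul_eq_mul, mul_one, Measure.real] at h0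
    exact ((ENNReal.toReal_eq_toReal_iff' (measure_ne_top _ _) (measure_ne_top _ _)).1 h0).symm

end Comparison

/-! ### The measure `mu` -/

section Mu

variable {q v : ℝ} {ω : ℝ → ℝ}

lemma mu_eq_sum :
    mu q v ω = Measure.sum fun n : ℤ =>
      (ENNReal.ofReal ((1 - q) * q ^ n) * (ENNReal.ofReal (|q ^ n| ^ (2 * v + 1)) *
        ENNReal.ofReal (ω (q ^ n) ^ 2))) • Measure.dirac (q ^ n) := by
  simp only [mu, sigma, dq, withDensity_sum, withDensity_smul_measure, dirac_withDensity,
    smul_smul, mul_assoc]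

lemma ae_mu : ∀ᵐ x ∂mu q v ω, ∃ k : ℤ, x = q ^ k := by
  rw [mu_eq_sum, Measure.ae_sum_iff' ?_]
  · intro n
    refine Measure.ae_smul_measure ?_ _
    rw [ae_dirac_eq]
    exact ⟨n, rfl⟩
  · have : {x : ℝ | ∃ k : ℤ, x = q ^ k} = Set.range fun k : ℤ => q ^ k := by
      ext x; simp [eq_comm]
    rw [this]
    exact (Set.countable_range _).measurableSet

lemma mu_singleton_pos (hq0 : 0 < q) (hq1 : q < 1) (n : ℤ) (hω : ω (q ^ n) ≠ 0) :
    0 < mu q v ω {q ^ n} := by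
  rw [mu_eq_sum]
  refine lt_of_lt_of_le ?_ (Measure.le_sum _ n _)
  have hn := zpow_pos hq0 n
  have h1 : 0 < (1 - q) * q ^ n := mul_pos (sub_pos.2 hq1) hn
  simp only [Measure.smul_apply, Measure.dirac_apply, Set.indicator_of_mem, Set.mem_singleton_iff,
    smul_eq_mul, Pi.one_apply, mul_one]
  refine ENNReal.mul_pos (ENNReal.ofReal_pos.2 h1).ne'
    (ENNReal.mul_pos (ENNReal.ofReal_pos.2 ?_).ne' (ENNReal.ofReal_pos.2 (by positivity)).ne').ne'
  exact Real.rpow_pos_of_pos (abs_pos.2 hn.ne') _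

lemma infinite_support_mu (hq0 : 0 < q) (hq1 : q < 1) (hω : ∀ n : ℤ, ω (q ^ n) ≠ 0) :
    (mu q v ω).support.Infinite := by
  refine (Set.infinite_range_of_injective (f := fun n : ℤ => q ^ n)
    (zpow_right_injective₀ hq0 hq1.ne)).mono ?_
  rintro _ ⟨n, rfl⟩
  rw [Measure.mem_support_iff_forall]
  intro U hU
  exact (mu_singleton_pos hq0 hq1 n (hω n)).trans_le
    (measure_mono (Set.singleton_subset_iff.2 (mem_of_mem_nhds hU)))

end Mu

end

end QMoment

theorem theorem2 (q v : ℝ) (hq0 : 0 < q) (hq1 : q < 1) (hv : -1 < v)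
    (ω : ℝ → ℝ) (hω_even : ∀ x : ℝ, ω (-x) = ω x) (hω_ne : ∀ n : ℤ, ω (q ^ n) ≠ 0)
    (hmom : ∀ n : ℕ, Integrable (fun x : ℝ => x ^ n) (QMoment.mu q v ω))
    (hlim : Tendsto
      (fun n : ℕ => q ^ ((n : ℝ) / 4) *
        QMoment.moment (QMoment.mu q v ω) (2 * n) ^ (1 / (2 * (n : ℝ))))
      atTop (𝓝 0)) :
    QMoment.IsDeterminate (QMoment.mu q v ω) := by
  have hmem : QMoment.mu q v ω ∈ QMoment.momentClass :=
    ⟨hmom, QMoment.infinite_support_mu hq0 hq1 hω_ne⟩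
  refine ⟨hmem, Set.Subset.antisymm ?_ (Set.singleton_subset_iff.2 ⟨hmem, fun _ => rfl⟩)⟩
  rintro ν ⟨⟨hν, -⟩, h⟩
  exact QMoment.eq_of_moment_eq hq0 hq1 hmom hν h QMoment.ae_mu hlim
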